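/- Let $n$ and $k$ be integers with $2\le k\le n$. For a non-zero $\xi\in\mathbb{R}^{n+1}$ and $q\ge 0$ put $$\mathcal{C}_\xi(e^q)=\{x\in\mathbb{R}^{n+1} : \|x\|\le 1,\ |x\cdot\xi|\le e^{-q}\},$$ where $x\cdot\xi$ is the standard scalar product and $\|x\|$ is the Euclidean norm. For $1\le j\le n+1$ let $L_{\xi,j}(q)=\log\lambda_j(\mathcal{C}_\xi(e^q);\mathbb{Z}^{n+1})$, where $\lambda_j(\mathcal{C};\mathbb{Z}^{n+1})$ is the $j$-th successive minimum of $\mathcal{C}$, i.e. the smallest $\lambda\ge 0$ such that $\lambda\mathcal{C}$ contains at least $j$ linearly independent points of $\mathbb{Z}^{n+1}$. Suppose that $\xi$ is a point of $\mathbb{R}^{n+1}$ whose $n+1$ coordinates are linearly independent over $\mathbb{Q}$ and which satisfies $$\lim_{q\to\infty}\frac{L_{\xi,k-1}(q)}{q}=0.$$ Then $$\liminf_{q\to\infty}\frac{L_{\xi,k+1}(q)}{q}\le\frac{1}{n-k+2}.$$ -/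

import Mathlib

open Filter Topology
open scoped Pointwise

/-- The `j`-th successive minimum of a set `C` (in practice a convex body) with respect to a
lattice `Λ`: the smallest `t ≥ 0` such that `t • C` contains at least `j` linearly independent
elements of `Λ`. -/
noncomputable def successiveMinimum {E : Type*} [AddCommGroup E] [Module ℝ E]
    (C : Set E) (Λ : Submodule ℤ E) (j : ℕ) : ℝ :=
  sInf {t : ℝ | 0 ≤ t ∧ ∃ v : Fin j → E, LinearIndependent ℝ v ∧ ∀ i, v i ∈ Λ ∧ v i ∈ t • C}

/-- The lattice `ℤ^m` in Euclidean space `ℝ^m`, generated by the standard basis. -/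
noncomputable def integerLattice (m : ℕ) : Submodule ℤ (EuclideanSpace ℝ (Fin m)) :=
  Submodule.span ℤ (Set.range (EuclideanSpace.basisFun (Fin m) ℝ).toBasis)

/-- The convex body of all `x` with `‖x‖ ≤ 1` (Euclidean norm) and `|x · ξ| ≤ Q⁻¹`. -/
def convexBodyC {m : ℕ} (ξ : EuclideanSpace ℝ (Fin m)) (Q : ℝ) :
    Set (EuclideanSpace ℝ (Fin m)) :=
  {x | ‖x‖ ≤ 1 ∧ |inner ℝ x ξ| ≤ Q⁻¹}

/-- `L_{ξ,j}(q)`, the logarithm of the `j`-th minimum of the body with parameter `Q = e^q`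
with respect to the integer lattice. -/
noncomputable def logMinimum {m : ℕ} (ξ : EuclideanSpace ℝ (Fin m)) (j : ℕ) (q : ℝ) : ℝ :=
  Real.log (successiveMinimum (convexBodyC ξ (Real.exp q)) (integerLattice m) j)

/-!
The functions `L_j = logMinimum ξ j` satisfy `L_k(q) ≤ q / (n - k + 2) + O(1)`, and `L_{k+1}`
comes close to `L_k` for arbitrarily large `q`; the theorem combines the two facts. Write `P γ q`
for the set of integer points `x` with `‖x‖ ≤ e^{γ q}` and `|x · ξ| ≤ e^{(γ - 1) q}`, that is, of
lattice points in `e^{γ q} • convexBodyC ξ (e^q)`.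

*Upper bound for `L_k`* (`eventually_le_finrank_span_latticePoints`). The box principle, applied to
the values `a · ξ` at the `(N + 1)^(n + 1)` integer points `a` of `[0, N]^(n + 1)`, puts at least a
constant times `N^(n + 1) e^{-q}` of them into one interval of length `N e^{-q}`. Their differences
lie in `P γ q` if `N` is a small multiple of `e^{γ q}`. A subspace of dimension less than `k` has
only `O(N^(k - 1))` integer points in a box of side `N` (`card_le_of_forall_mem_subspace`). Hence
`P γ q` spans a space of dimension at least `k` as soon as `γ (n - k + 2) > 1` and `q` is large.

*Infinitely many near-coincidences of `L_k` and `L_{k+1}`.* If the lower limit of `L_{k+1}(q) / q`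
exceeded `γ > γ' > 1 / (n - k + 2)`, then for large `q` the sets `P γ q`, `P γ' q` and `P γ' (q + 1)`
would span the same subspace, of dimension `k`. This subspace `W` would then not depend on the large
integer `q`. As `k < n + 1`, some integer point `y` is outside `W`. As the coordinates of `ξ` are
independent over `ℚ`, the subspace `W`, which contains a nonzero integer point, contains a vector `v`
with `v · ξ = y · ξ`. Writing `v` in a basis of `W` taken from `P γ' q` and rounding the coefficients
gives an integer point `u` of `W` such that `y - u` is in `P γ q`, hence in `W`: a contradiction
(`exists_mem_span_sub_mem_latticePoints`).
-/

/-! ### Integer points -/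

/-- The vector of Euclidean space with the integer coordinates `a`. -/
noncomputable def intPoint {m : ℕ} (a : Fin m → ℤ) : EuclideanSpace ℝ (Fin m) :=
  WithLp.toLp 2 fun i => (a i : ℝ)

@[simp]
theorem intPoint_apply {m : ℕ} (a : Fin m → ℤ) (i : Fin m) : intPoint a i = a i := rfl

theorem intPoint_sub {m : ℕ} (a b : Fin m → ℤ) : intPoint (a - b) = intPoint a - intPoint b := by
  ext i; simp

theorem inner_intPoint {m : ℕ} (a : Fin m → ℤ) (ξ : EuclideanSpace ℝ (Fin m)) :
    inner ℝ (intPoint a) ξ = ∑ i, (a i : ℝ) * ξ i := by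
  simp [PiLp.inner_apply, mul_comm]

theorem mem_integerLattice_iff {m : ℕ} {x : EuclideanSpace ℝ (Fin m)} :
    x ∈ integerLattice m ↔ ∃ a : Fin m → ℤ, x = intPoint a := by
  rw [integerLattice, Module.Basis.mem_span_iff_repr_mem]
  simp only [OrthonormalBasis.coe_toBasis_repr_apply, EuclideanSpace.basisFun_repr,
    algebraMap_int_eq, Set.mem_range, eq_intCast]
  constructor
  · intro h
    choose a ha using h
    exact ⟨a, by ext i; simp [ha]⟩
  · rintro ⟨a, rfl⟩ i
    exact ⟨a i, rfl⟩

theorem inner_ne_zero_of_mem_integerLattice {m : ℕ} {ξ x : EuclideanSpace ℝ (Fin m)}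
    (hξ : LinearIndependent ℚ (fun i : Fin m => ξ i)) (hx : x ∈ integerLattice m) (hx0 : x ≠ 0) :
    inner ℝ x ξ ≠ 0 := by
  obtain ⟨a, rfl⟩ := mem_integerLattice_iff.1 hx
  intro h
  rw [inner_intPoint] at h
  refine hx0 ?_
  ext i
  have h0 := Fintype.linearIndependent_iff.1 hξ (fun i => (a i : ℚ)) (by
    simpa [Rat.smul_def] using h) i
  have : a i = 0 := by exact_mod_cast h0
  simp [this]

theorem norm_intPoint_le {m : ℕ} {a : Fin m → ℤ} {N : ℝ} (ha : ∀ i, |(a i : ℝ)| ≤ N) :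
    ‖intPoint a‖ ≤ m * N := by
  have h : intPoint a = ∑ i, (a i : ℝ) • EuclideanSpace.single i (1 : ℝ) := by
    ext j
    simp [Pi.single_apply]
  calc ‖intPoint a‖ ≤ ∑ i, ‖(a i : ℝ) • EuclideanSpace.single i (1 : ℝ)‖ := by
        rw [h]; exact norm_sum_le _ _
    _ ≤ ∑ _i : Fin m, N := Finset.sum_le_sum fun i _ => by
        simpa [norm_smul] using ha i
    _ = m * N := by simp

/-! ### Integer points of a subspace, and the box principle -/

/-- Among the coordinates one can choose at most `dim W` that determine the points of `W`: a basis
of the span of the coordinate functionals in the dual of `W`. -/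
theorem exists_coordinates_injective {m : ℕ} (W : Submodule ℝ (EuclideanSpace ℝ (Fin m))) :
    ∃ r ≤ Module.finrank ℝ W, ∃ c : Fin r → Fin m,
      ∀ w ∈ W, (∀ i, w (c i) = 0) → w = 0 := by
  let p : Fin m → Module.Dual ℝ W := fun i =>
    (EuclideanSpace.proj i : EuclideanSpace ℝ (Fin m) →L[ℝ] ℝ).toLinearMap ∘ₗ W.subtype
  obtain ⟨f, hf, hspan, -⟩ := Submodule.exists_fun_fin_finrank_span_eq ℝ (Set.range p)
  choose c hc using hf
  refine ⟨_, (Submodule.finrank_le _).trans Subspace.dual_finrank_eq.le, c, fun w hw h => ?_⟩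
  have hle : Submodule.span ℝ (Set.range f) ≤
      LinearMap.ker (Module.Dual.eval ℝ W ⟨w, hw⟩) := by
    rw [Submodule.span_le]
    rintro _ ⟨i, rfl⟩
    rw [← hc i]
    simpa [p] using h i
  ext i
  have : p i ∈ LinearMap.ker (Module.Dual.eval ℝ W ⟨w, hw⟩) :=
    hle (hspan.symm.le (Submodule.subset_span ⟨i, rfl⟩))
  simpa [p] using this

theorem card_le_of_forall_mem_subspace {m N : ℕ} (W : Submodule ℝ (EuclideanSpace ℝ (Fin m)))
    (T : Finset (Fin m → ℤ)) (hN : ∀ a ∈ T, ∀ i, |a i| ≤ N) (hW : ∀ a ∈ T, intPoint a ∈ W) :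
    T.card ≤ (2 * N + 1) ^ Module.finrank ℝ W := by
  obtain ⟨r, hr, c, hc⟩ := exists_coordinates_injective W
  have h1 : T.card ≤ (Fintype.piFinset fun _ : Fin r => Finset.Icc (-(N : ℤ)) N).card := by
    refine Finset.card_le_card_of_injOn (fun a i => a (c i)) ?_ ?_
    · intro a ha
      simp only [Finset.mem_coe, Fintype.mem_piFinset, Finset.mem_Icc]
      exact fun i => abs_le.1 (hN a ha (c i))
    · intro a ha b hb hab
      have h0 := hc (intPoint (a - b))
        (by rw [intPoint_sub]; exact W.sub_mem (hW a ha) (hW b hb)) fun i => by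
          have := congrFun hab i
          simp only at this
          simp [this]
      funext i
      have h2 : intPoint (a - b) i = 0 := by rw [h0]; rfl
      rw [intPoint_apply] at h2
      have h3 : (a - b) i = 0 := by exact Int.cast_eq_zero.1 h2
      simpa [sub_eq_zero] using h3
  refine h1.trans ?_
  rw [Fintype.card_piFinset_const, Int.card_Icc]
  calc _ = (2 * N + 1) ^ r := by congr 1; omega
    _ ≤ _ := Nat.pow_le_pow_right (by omega) hr

/-- If all integer points `a` with `|a i| ≤ N` and `|a · ξ| ≤ ε` lie in the subspace `W`, then `W`
cannot be too small: each of the intervals of length `ε` that cover the values `a · ξ` for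
`a ∈ [0, N]^m` receives at most as many points as `W` has integer points in `[-N, N]^m`. -/
theorem box_principle {m N : ℕ} (ξ : EuclideanSpace ℝ (Fin m)) {ε : ℝ} (hε : 0 < ε)
    (W : Submodule ℝ (EuclideanSpace ℝ (Fin m)))
    (hW : ∀ a : Fin m → ℤ, (∀ i, |a i| ≤ N) → |inner ℝ (intPoint a) ξ| ≤ ε → intPoint a ∈ W) :
    ((N : ℝ) + 1) ^ m ≤
      (2 * N + 1) ^ Module.finrank ℝ W * (2 * (N * (∑ i, |ξ i|) / ε) + 2) := by
  set x : ℝ := N * (∑ i, |ξ i|) / ε with hx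
  have hx0 : 0 ≤ x := by positivity
  let A : Finset (Fin m → ℤ) := Fintype.piFinset fun _ => Finset.Icc 0 (N : ℤ)
  have hA : ∀ a ∈ A, ∀ i, 0 ≤ a i ∧ a i ≤ N := fun a ha i =>
    Finset.mem_Icc.1 (Fintype.mem_piFinset.1 ha i)
  let f : (Fin m → ℤ) → ℤ := fun a => ⌊inner ℝ (intPoint a) ξ / ε⌋
  have hmaps : ∀ a ∈ A, f a ∈ Finset.Icc ⌊-x⌋ ⌊x⌋ := by
    intro a ha
    have h1 : |inner ℝ (intPoint a) ξ / ε| ≤ x := by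
      rw [abs_div, abs_of_pos hε, hx]
      gcongr
      rw [inner_intPoint, Finset.mul_sum]
      refine (Finset.abs_sum_le_sum_abs _ _).trans (Finset.sum_le_sum fun i _ => ?_)
      rw [abs_mul]
      gcongr
      obtain ⟨h0, h2⟩ := hA a ha i
      rw [abs_of_nonneg (by exact_mod_cast h0)]
      exact_mod_cast h2
    exact Finset.mem_Icc.2 ⟨Int.floor_mono (abs_le.1 h1).1, Int.floor_mono (abs_le.1 h1).2⟩
  have hfib : ∀ b ∈ Finset.Icc ⌊-x⌋ ⌊x⌋,
      (A.filter fun a => f a = b).card ≤ (2 * N + 1) ^ Module.finrank ℝ W := by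
    intro b _
    rcases (A.filter fun a => f a = b).eq_empty_or_nonempty with he | ⟨a₀, ha₀⟩
    · simp [he]
    rw [← Finset.card_image_of_injective _ (sub_left_injective (b := a₀))]
    have hbd : ∀ a ∈ (A.filter fun a => f a = b).image (fun a => a - a₀), ∀ i, |a i| ≤ N := by
      intro a ha i
      obtain ⟨a', ha', rfl⟩ := Finset.mem_image.1 ha
      have h1 := hA a' (Finset.mem_filter.1 ha').1 i
      have h2 := hA a₀ (Finset.mem_filter.1 ha₀).1 i
      simp only [Pi.sub_apply, abs_le]
      omega
    refine card_le_of_forall_mem_subspace W _ hbd fun a ha => hW a (hbd a ha) ?_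
    obtain ⟨a', ha', rfl⟩ := Finset.mem_image.1 ha
    have h1 : f a' = f a₀ := (Finset.mem_filter.1 ha').2.trans (Finset.mem_filter.1 ha₀).2.symm
    have h2 := Int.abs_sub_lt_one_of_floor_eq_floor h1
    rw [← sub_div, abs_div, abs_of_pos hε, div_lt_one hε] at h2
    rw [intPoint_sub, inner_sub_left]
    exact h2.le
  have hcard := Finset.card_le_mul_card_image_of_maps_to hmaps _ hfib
  have hAcard : A.card = (N + 1) ^ m := by
    simp only [A, Fintype.card_piFinset_const, Int.card_Icc]
    congr 1
  rw [hAcard] at hcard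
  have ht : ((Finset.Icc ⌊-x⌋ ⌊x⌋).card : ℝ) ≤ 2 * x + 2 := by
    have h1 : ((Finset.Icc ⌊-x⌋ ⌊x⌋).card : ℤ) = ⌊x⌋ + 1 - ⌊-x⌋ := by
      rw [Int.card_Icc, Int.toNat_of_nonneg]
      have : ⌊-x⌋ ≤ ⌊x⌋ := Int.floor_mono (by linarith)
      omega
    have h2 : ((Finset.Icc ⌊-x⌋ ⌊x⌋).card : ℝ) = ⌊x⌋ + 1 - ⌊-x⌋ := by exact_mod_cast h1
    have h3 := Int.floor_le x
    have h4 := Int.lt_floor_add_one (-x)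
    linarith
  calc ((N : ℝ) + 1) ^ m
      ≤ (2 * N + 1) ^ Module.finrank ℝ W * ((Finset.Icc ⌊-x⌋ ⌊x⌋).card : ℝ) := by
        exact_mod_cast hcard
    _ ≤ _ := by gcongr

/-! ### Lattice points in the dilated bodies -/

/-- The integer points in `e^{γ q} • convexBodyC ξ (e^q)`. -/
def latticePoints {m : ℕ} (ξ : EuclideanSpace ℝ (Fin m)) (γ q : ℝ) :
    Set (EuclideanSpace ℝ (Fin m)) :=
  {x | x ∈ integerLattice m ∧ ‖x‖ ≤ Real.exp (γ * q) ∧ |inner ℝ x ξ| ≤ Real.exp ((γ - 1) * q)}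

theorem mem_smul_convexBodyC {m : ℕ} {ξ x : EuclideanSpace ℝ (Fin m)} {γ q : ℝ}
    (h : x ∈ latticePoints ξ γ q) : x ∈ Real.exp (γ * q) • convexBodyC ξ (Real.exp q) := by
  have hpos := Real.exp_pos (γ * q)
  rw [Set.mem_smul_set_iff_inv_smul_mem₀ hpos.ne']
  refine ⟨?_, ?_⟩
  · rw [norm_smul, norm_inv, Real.norm_of_nonneg hpos.le, inv_mul_le_iff₀ hpos, mul_one]
    exact h.2.1
  · rw [real_inner_smul_left, abs_mul, abs_inv, abs_of_pos hpos, inv_mul_le_iff₀ hpos,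
      ← Real.exp_neg, ← Real.exp_add]
    exact h.2.2.trans_eq (by congr 1; ring)

theorem finrank_span_latticePoints_lt {m j : ℕ} {ξ : EuclideanSpace ℝ (Fin m)} {γ q : ℝ}
    (hγ : 0 ≤ γ * q) (h : γ * q < logMinimum ξ j q) :
    Module.finrank ℝ (Submodule.span ℝ (latticePoints ξ γ q)) < j := by
  by_contra! hj
  obtain ⟨f, hf, -, hind⟩ := Submodule.exists_fun_fin_finrank_span_eq ℝ (latticePoints ξ γ q)
  have hle : successiveMinimum (convexBodyC ξ (Real.exp q)) (integerLattice m) j ≤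
      Real.exp (γ * q) :=
    csInf_le ⟨0, fun t ht => ht.1⟩ ⟨(Real.exp_pos _).le, f ∘ Fin.castLE hj,
      hind.comp _ (Fin.castLE_injective hj), fun i => ⟨(hf _).1, mem_smul_convexBodyC (hf _)⟩⟩
  have h0 : 0 ≤ successiveMinimum (convexBodyC ξ (Real.exp q)) (integerLattice m) j :=
    Real.sInf_nonneg fun t ht => ht.1
  -- The minimum is positive, since `log 0 = 0` is not larger than `γ * q`.
  rcases h0.eq_or_lt with h0 | h0
  · rw [logMinimum, ← h0, Real.log_zero] at h
    linarith
  · rw [logMinimum, Real.lt_log_iff_exp_lt h0] at h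
    linarith

/-- The bound `L_k(q) ≤ q / (m + 1 - k) + o(q)`, in terms of lattice points; here `d` stands for
`m + 1 - k`. -/
theorem eventually_le_finrank_span_latticePoints {m k d : ℕ} (hk : 1 ≤ k) (hd : k - 1 + d = m)
    (ξ : EuclideanSpace ℝ (Fin m)) {γ : ℝ} (hγ : 1 < γ * d) :
    ∀ᶠ q : ℝ in atTop,
      k ≤ Module.finrank ℝ (Submodule.span ℝ (latticePoints ξ γ q)) := by
  have hd0 : (0 : ℝ) < d := by
    rcases Nat.eq_zero_or_pos d with h | h
    · subst h; norm_num at hγ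
    · exact_mod_cast h
  have hm0 : (0 : ℝ) < m := by
    have : 0 < d := by exact_mod_cast hd0
    exact_mod_cast (by omega : 0 < m)
  have hγ0 : 0 < γ := pos_of_mul_pos_left (by linarith) hd0.le
  set B : ℝ := ∑ i, |ξ i|
  have hB : 0 ≤ B := by positivity
  set C : ℝ := m ^ d * (2 ^ (k - 1) * (2 * B + 2)) with hC
  have h1 : ∀ᶠ q : ℝ in atTop, C < Real.exp ((γ * d - 1) * q) :=
    (Real.tendsto_exp_atTop.comp (tendsto_id.const_mul_atTop (sub_pos.2 hγ))).eventually_gt_atTop C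
  have h2 : ∀ᶠ q : ℝ in atTop, (m : ℝ) ≤ Real.exp (γ * q) :=
    (Real.tendsto_exp_atTop.comp (tendsto_id.const_mul_atTop hγ0)).eventually_ge_atTop _
  filter_upwards [h1, h2, eventually_ge_atTop 0] with q hq1 hq2 hq0
  by_contra! hlt
  -- The largest `N` for which the box `[-N, N]^m` is seen to lie in the ball of radius `e^{γ q}`.
  set N : ℕ := ⌊Real.exp (γ * q) / m⌋₊ with hN
  have hNle : m * (N : ℝ) ≤ Real.exp (γ * q) := by
    have := Nat.floor_le (show 0 ≤ Real.exp (γ * q) / m by positivity)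
    rw [le_div_iff₀ hm0] at this
    linarith
  have hNlt : Real.exp (γ * q) / m < N + 1 := Nat.lt_floor_add_one _
  have hN1 : (1 : ℝ) ≤ N := by
    have : 1 ≤ N := Nat.le_floor (by rw [Nat.cast_one, le_div_iff₀ hm0]; linarith)
    exact_mod_cast this
  have hm1 : (1 : ℝ) ≤ m := by
    have : 0 < m := by exact_mod_cast hm0
    exact_mod_cast this
  have hbox := box_principle (N := N) ξ (ε := N * Real.exp (-q)) (by positivity)
    (Submodule.span ℝ (latticePoints ξ γ q)) fun a ha hin => Submodule.subset_span
      ⟨mem_integerLattice_iff.2 ⟨a, rfl⟩,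
        (norm_intPoint_le fun i => by exact_mod_cast ha i).trans hNle, by
          refine hin.trans ?_
          rw [sub_mul, one_mul, sub_eq_add_neg, Real.exp_add]
          gcongr
          nlinarith⟩
  have hcell : (N : ℝ) * B / (N * Real.exp (-q)) = B * Real.exp q := by
    rw [Real.exp_neg]
    field_simp
  rw [hcell] at hbox
  have hE : 1 ≤ Real.exp q := Real.one_le_exp hq0
  have h3 : ((N : ℝ) + 1) ^ (k - 1) * (N + 1) ^ d ≤
      ((N : ℝ) + 1) ^ (k - 1) * (2 ^ (k - 1) * (2 * B + 2) * Real.exp q) := by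
    calc ((N : ℝ) + 1) ^ (k - 1) * (N + 1) ^ d = ((N : ℝ) + 1) ^ m := by rw [← pow_add, hd]
      _ ≤ _ := hbox
      _ ≤ (2 * ((N : ℝ) + 1)) ^ (k - 1) * ((2 * B + 2) * Real.exp q) := by
        gcongr ?_ * ?_
        · calc (2 * (N : ℝ) + 1) ^ _ ≤ (2 * (N : ℝ) + 1) ^ (k - 1) :=
                pow_le_pow_right₀ (by linarith) (by omega)
            _ ≤ _ := by gcongr; linarith
        · nlinarith
      _ = _ := by rw [mul_pow]; ring
  have h4 := le_of_mul_le_mul_left h3 (by positivity)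
  have h5 : (Real.exp (γ * q)) ^ d ≤ C * Real.exp q := by
    calc (Real.exp (γ * q)) ^ d = m ^ d * (Real.exp (γ * q) / m) ^ d := by
          rw [← mul_pow, mul_div_cancel₀ _ hm0.ne']
      _ ≤ m ^ d * (2 ^ (k - 1) * (2 * B + 2) * Real.exp q) := by
          gcongr
          exact (pow_le_pow_left₀ (by positivity) hNlt.le d).trans h4
      _ = _ := by rw [hC]; ring
  have h6 : (Real.exp (γ * q)) ^ d = Real.exp ((γ * d - 1) * q) * Real.exp q := by
    rw [← Real.exp_nat_mul, ← Real.exp_add]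
    congr 1
    ring
  rw [h6] at h5
  exact absurd (le_of_mul_le_mul_right h5 (Real.exp_pos q)) (not_le.2 hq1)

theorem latticePoints_subset {m : ℕ} (ξ : EuclideanSpace ℝ (Fin m)) {γ' γ q q' : ℝ}
    (h1 : γ' * q' ≤ γ * q) (h2 : (γ' - 1) * q' ≤ (γ - 1) * q) :
    latticePoints ξ γ' q' ⊆ latticePoints ξ γ q := fun _ hx =>
  ⟨hx.1, hx.2.1.trans (Real.exp_le_exp.2 h1), hx.2.2.trans (Real.exp_le_exp.2 h2)⟩

/-- Rounding the coefficients of `v` in a basis of the span consisting of points of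
`latticePoints ξ γ' q` gives an integer point `u` that is close to `v` both in norm and in scalar
product with `ξ`; if `v · ξ = y · ξ`, then `y - u` is small in both senses. -/
theorem exists_mem_span_sub_mem_latticePoints {m : ℕ} {ξ y v : EuclideanSpace ℝ (Fin m)}
    {γ' γ q : ℝ} (hy : y ∈ integerLattice m) (hv : v ∈ Submodule.span ℝ (latticePoints ξ γ' q))
    (hvy : inner ℝ v ξ = inner ℝ y ξ) (hq : 0 ≤ γ' * q)
    (hlarge : ‖y - v‖ + m ≤ Real.exp ((γ - γ') * q)) :
    ∃ u ∈ Submodule.span ℝ (latticePoints ξ γ' q), y - u ∈ latticePoints ξ γ q := by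
  obtain ⟨f, hf, hspan, -⟩ := Submodule.exists_fun_fin_finrank_span_eq ℝ (latticePoints ξ γ' q)
  rw [← hspan] at hv
  obtain ⟨c, hc⟩ := (Submodule.mem_span_range_iff_exists_fun ℝ).1 hv
  have hcard : (Module.finrank ℝ (Submodule.span ℝ (latticePoints ξ γ' q)) : ℝ) ≤ m := by
    exact_mod_cast (Submodule.finrank_le _).trans finrank_euclideanSpace_fin.le
  have hround : ∀ i, |c i - round (c i)| ≤ 1 := fun i => (abs_sub_round _).trans (by norm_num)
  set u := ∑ i, round (c i) • f i with hu
  have hyu : y - u = (y - v) + ∑ i, (c i - round (c i)) • f i := by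
    rw [hu, ← hc]
    simp only [sub_smul, Finset.sum_sub_distrib, Int.cast_smul_eq_zsmul]
    abel
  have hgap : ∀ a : ℝ, Real.exp ((γ - γ') * q) * Real.exp (a + γ' * q) = Real.exp (a + γ * q) := by
    intro a
    rw [← Real.exp_add]
    congr 1
    ring
  refine ⟨u, ?_, ?_, ?_, ?_⟩
  · exact sum_mem fun i _ => zsmul_mem (Submodule.subset_span (hf i)) _
  · exact sub_mem hy (sum_mem fun i _ => Submodule.smul_mem _ _ (hf i).1)
  · calc ‖y - u‖ ≤ ‖y - v‖ + ∑ i, ‖(c i - round (c i)) • f i‖ := by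
          rw [hyu]
          exact (norm_add_le _ _).trans (by gcongr; exact norm_sum_le _ _)
      _ ≤ ‖y - v‖ + ∑ _i : Fin (Module.finrank ℝ (Submodule.span ℝ (latticePoints ξ γ' q))),
            Real.exp (γ' * q) := by
          gcongr with i
          rw [norm_smul]
          exact (mul_le_mul (hround i) (hf i).2.1 (norm_nonneg _) zero_le_one).trans_eq (one_mul _)
      _ ≤ ‖y - v‖ * Real.exp (γ' * q) + m * Real.exp (γ' * q) := by
          simp only [Finset.sum_const, Finset.card_univ, Fintype.card_fin, nsmul_eq_mul]
          gcongr
          exact le_mul_of_one_le_right (norm_nonneg _) (Real.one_le_exp hq)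
      _ = (‖y - v‖ + m) * Real.exp (γ' * q) := by ring
      _ ≤ Real.exp ((γ - γ') * q) * Real.exp (γ' * q) := by gcongr
      _ = Real.exp (γ * q) := by simpa using hgap 0
  · have hin : inner ℝ (y - u) ξ = ∑ i, (c i - round (c i)) * inner ℝ (f i) ξ := by
      rw [hyu, inner_add_left, inner_sub_left, hvy, sub_self, zero_add, sum_inner]
      simp only [real_inner_smul_left]
    calc |inner ℝ (y - u) ξ|
        ≤ ∑ i, |(c i - round (c i)) * inner ℝ (f i) ξ| := by
          rw [hin]; exact Finset.abs_sum_le_sum_abs _ _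
      _ ≤ ∑ _i : Fin (Module.finrank ℝ (Submodule.span ℝ (latticePoints ξ γ' q))),
            Real.exp ((γ' - 1) * q) := by
          gcongr with i
          rw [abs_mul]
          exact (mul_le_mul (hround i) (hf i).2.2 (abs_nonneg _) zero_le_one).trans_eq (one_mul _)
      _ ≤ m * Real.exp ((γ' - 1) * q) := by
          simp only [Finset.sum_const, Finset.card_univ, Fintype.card_fin, nsmul_eq_mul]
          gcongr
      _ ≤ Real.exp ((γ - γ') * q) * Real.exp ((γ' - 1) * q) := by
          gcongr
          linarith [norm_nonneg (y - v)]
      _ = Real.exp ((γ - 1) * q) := by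
          rw [← Real.exp_add]
          congr 1
          ring

/-! ### The spans cannot stabilize -/

/-- If `W` is a proper nonzero subspace that is spanned by `latticePoints ξ γ' q` for all large
integers `q`, then some of the larger sets `latticePoints ξ γ q`, `γ > γ'`, leave `W`. -/
theorem not_eventually_latticePoints_subset {m : ℕ} {ξ : EuclideanSpace ℝ (Fin m)}
    (hξ : LinearIndependent ℚ (fun i : Fin m => ξ i)) {γ' γ : ℝ} (h0 : 0 ≤ γ') (hγ : γ' < γ)
    {W : Submodule ℝ (EuclideanSpace ℝ (Fin m))} (hbot : W ≠ ⊥) (htop : W ≠ ⊤)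
    (hspan : ∀ᶠ q : ℕ in atTop, Submodule.span ℝ (latticePoints ξ γ' q) = W) :
    ¬ ∀ᶠ q : ℕ in atTop, latticePoints ξ γ q ⊆ W := by
  intro hsub
  obtain ⟨x, hxL, hxW, hx0⟩ : ∃ x ∈ integerLattice m, x ∈ W ∧ x ≠ 0 := by
    obtain ⟨q, hq⟩ := hspan.exists
    by_contra! h
    refine hbot (eq_bot_iff.2 ?_)
    rw [← hq, Submodule.span_le]
    exact fun x hx => h x hx.1 (hq ▸ Submodule.subset_span hx)
  obtain ⟨y, hyL, hyW⟩ : ∃ y ∈ integerLattice m, y ∉ W := by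
    by_contra! h
    refine htop (eq_top_iff.2 ?_)
    rw [← (EuclideanSpace.basisFun (Fin m) ℝ).toBasis.span_eq, Submodule.span_le]
    exact fun y hy => h y (Submodule.subset_span hy)
  have hxξ := inner_ne_zero_of_mem_integerLattice hξ hxL hx0
  set v := (inner ℝ y ξ / inner ℝ x ξ) • x with hv
  have hvy : inner ℝ v ξ = inner ℝ y ξ := by
    rw [hv, real_inner_smul_left, div_mul_cancel₀ _ hxξ]
  have hlarge : ∀ᶠ q : ℕ in atTop, ‖y - v‖ + m ≤ Real.exp ((γ - γ') * q) :=
    ((Real.tendsto_exp_atTop.comp (tendsto_id.const_mul_atTop (sub_pos.2 hγ))).comp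
      tendsto_natCast_atTop_atTop).eventually_ge_atTop _
  obtain ⟨q, hq1, hq2, hq3⟩ := (hspan.and (hsub.and hlarge)).exists
  obtain ⟨u, hu, hyu⟩ := exists_mem_span_sub_mem_latticePoints hyL
    (hq1 ▸ W.smul_mem _ hxW : v ∈ _) hvy (by positivity) hq3
  rw [hq1] at hu
  exact hyW (by simpa using W.add_mem (hq2 hyu) hu)

theorem theorem3 (n k : ℕ) (hk : 2 ≤ k) (hkn : k ≤ n)
    (ξ : EuclideanSpace ℝ (Fin (n + 1)))
    (hξ : LinearIndependent ℚ (fun i : Fin (n + 1) => ξ i))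
    (hlim : Tendsto (fun q : ℝ => logMinimum ξ (k - 1) q / q) atTop (𝓝 0)) :
    liminf (fun q : ℝ => ((logMinimum ξ (k + 1) q / q : ℝ) : EReal)) atTop
      ≤ ((1 / ((n : ℝ) - (k : ℝ) + 2) : ℝ) : EReal) := by
  by_contra! hlt
  obtain ⟨γ, hγ, hγlim⟩ := EReal.lt_iff_exists_real_btwn.1 hlt
  have hγ1 : 1 / ((n : ℝ) - k + 2) < γ := by exact_mod_cast hγ
  obtain ⟨γ', hγ', hγ'γ⟩ := exists_between hγ1
  have hkn' : (k : ℝ) ≤ n := by exact_mod_cast hkn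
  have hγ'0 : 0 < γ' := lt_trans (by apply one_div_pos.2; linarith) hγ'
  have hd : 1 < γ' * ((n + 2 - k : ℕ) : ℝ) := by
    rw [Nat.cast_sub (by omega)]
    push_cast
    rw [div_lt_iff₀ (by linarith)] at hγ'
    linarith
  have hlow := tendsto_natCast_atTop_atTop.eventually
    (eventually_le_finrank_span_latticePoints (k := k) (by omega) (by omega) ξ hd)
  have hup : ∀ᶠ q : ℕ in atTop,
      Module.finrank ℝ (Submodule.span ℝ (latticePoints ξ γ q)) ≤ k := by
    refine tendsto_natCast_atTop_atTop.eventually (p := fun q : ℝ =>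
      Module.finrank ℝ (Submodule.span ℝ (latticePoints ξ γ q)) ≤ k) ?_
    filter_upwards [eventually_lt_of_lt_liminf hγlim, eventually_gt_atTop 0] with q hq hq0
    have hq' : γ < logMinimum ξ (k + 1) q / q := by exact_mod_cast hq
    rw [lt_div_iff₀ hq0] at hq'
    have hγ0 : 0 < γ := hγ'0.trans hγ'γ
    exact Nat.lt_succ_iff.1 (finrank_span_latticePoints_lt (by positivity) hq')
  have hgap : ∀ᶠ q : ℕ in atTop, γ' ≤ (γ - γ') * (q : ℝ) :=
    ((tendsto_id.const_mul_atTop (sub_pos.2 hγ'γ)).comp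
      tendsto_natCast_atTop_atTop).eventually_ge_atTop _
  obtain ⟨Q, hQ⟩ := eventually_atTop.1 (hlow.and (hup.and hgap))
  -- All spans in question have dimension `k`, so inclusions between them are equalities.
  have heq : ∀ q : ℕ, Q ≤ q → ∀ q' : ℕ, Q ≤ q' → latticePoints ξ γ' q' ⊆ latticePoints ξ γ q →
      Submodule.span ℝ (latticePoints ξ γ' q') = Submodule.span ℝ (latticePoints ξ γ q) :=
    fun q hq q' hq' h => Submodule.eq_of_le_of_finrank_le (Submodule.span_mono h)
      ((hQ q hq).2.1.trans (hQ q' hq').1)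
  have hself : ∀ q : ℕ, Q ≤ q →
      Submodule.span ℝ (latticePoints ξ γ' q) = Submodule.span ℝ (latticePoints ξ γ q) :=
    fun q hq => heq q hq q hq (latticePoints_subset ξ (by gcongr) (by gcongr))
  have hconst : ∀ q : ℕ, Q ≤ q →
      Submodule.span ℝ (latticePoints ξ γ' q) = Submodule.span ℝ (latticePoints ξ γ' Q) := by
    intro q hq
    induction q, hq using Nat.le_induction with
    | base => rfl
    | succ q hq ih =>
      rw [← ih, hself q hq]
      have := (hQ q hq).2.2
      refine heq q hq (q + 1) (by omega) (latticePoints_subset ξ ?_ ?_) <;> push_cast <;> nlinarith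
  have hdim : Module.finrank ℝ (Submodule.span ℝ (latticePoints ξ γ' Q)) = k :=
    le_antisymm (hself Q le_rfl ▸ (hQ Q le_rfl).2.1) (hQ Q le_rfl).1
  refine not_eventually_latticePoints_subset hξ hγ'0.le hγ'γ
    (W := Submodule.span ℝ (latticePoints ξ γ' Q)) ?_ ?_
    (eventually_atTop.2 ⟨Q, hconst⟩) (eventually_atTop.2 ⟨Q, fun q hq => ?_⟩)
  · intro h
    rw [h, finrank_bot] at hdim
    omega
  · intro h
    rw [h, finrank_top, finrank_euclideanSpace_fin] at hdim
    omega
  · rw [← hconst q hq, hself q hq]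
    exact Submodule.subset_span
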